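/- Let $K\subset\mathbb{R}^d$ be compact and let $\mathcal{P}_2(K)$ be the set of Borel probability measures on $K$ (their second moments are automatically finite), with the topology of weak convergence of measures. For $\mu,\nu\in\mathcal{P}_2(K)$ let $$SW_2^2(\mu,\nu)=\int_{S^{d-1}} W_2^2\big(P^\theta_\#\mu,P^\theta_\#\nu\big)\,\mathrm{d}\lambda(\theta),\qquad P^\theta(x)=\langle x,\theta\rangle,$$ where $\lambda$ is the uniform probability measure on the unit sphere $S^{d-1}$ and $W_2^2(\alpha,\beta)=\inf_\pi\int |s-t|^2\,\mathrm{d}\pi(s,t)$, the infimum being over all couplings $\pi$ of the probability measures $\alpha,\beta$ on $\mathbb{R}$. Let $\mathcal{F}:\mathcal{P}_2(K)\to\mathbb{R}$ be lower semicontinuous, let $\tau>0$ and $\mu_k\in\mathcal{P}_2(K)$. Then the problem $$\min_{\mu\in\mathcal{P}_2(K)}\ \frac{SW_2^2(\mu,\mu_k)}{2\tau}+\mathcal{F}(\mu)$$ has a minimizer. Moreover, the minimizer is unique in each of the following two cases: 1. $\mu_k$ is absolutely continuous with respect to the Lebesgue measure on $\mathbb{R}^d$ and $\mathcal{F}$ is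 convex, i.e. $\mathcal{F}((1-t)\mu+t\nu)\le(1-t)\mathcal{F}(\mu)+t\mathcal{F}(\nu)$ for all $\mu,\nu\in\mathcal{P}_2(K)$ and $t\in[0,1]$; 2. $\mathcal{F}$ is strictly convex, i.e. this inequality is strict whenever $\mu\neq\nu$ and $0<t<1$. -/

import Mathlib

open MeasureTheory
open scoped ENNReal

noncomputable section

namespace SWJKO

/-- Euclidean space `ℝ^d`. -/
abbrev Euc (d : ℕ) : Type := EuclideanSpace ℝ (Fin d)

/-- `P₂(K)` for a compact `K ⊆ ℝ^d`: the Borel probability measures on `K`, with Mathlib's topology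
of weak convergence. Finiteness of the second moment is automatic since `K` is bounded. -/
abbrev P2 {d : ℕ} (K : Set (Euc d)) : Type := ProbabilityMeasure K

/-- A measure on `K`, seen as a measure on `ℝ^d`. -/
def toEuc {d : ℕ} {K : Set (Euc d)} (μ : P2 K) : Measure (Euc d) :=
  (μ : Measure K).map Subtype.val

/-- `π` is a coupling (transport plan) of `μ` and `ν`. -/
def IsCoupling (π : Measure (ℝ × ℝ)) (μ ν : Measure ℝ) : Prop :=
  π.fst = μ ∧ π.snd = ν

/-- The squared Wasserstein distance `W₂²(μ, ν) = inf_π ∫ |x - y|² dπ(x, y)` on the line,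
the infimum being over all couplings. -/
def wassersteinSq (μ ν : Measure ℝ) : ℝ≥0∞ :=
  ⨅ (π : Measure (ℝ × ℝ)) (_ : IsCoupling π μ ν), ∫⁻ p, edist p.1 p.2 ^ 2 ∂π

/-- The uniform probability measure on the unit sphere `S^{d-1}`. -/
def sphereUniform (d : ℕ) : Measure (Metric.sphere (0 : Euc d) 1) :=
  ((volume : Measure (Euc d)).toSphere Set.univ)⁻¹ • (volume : Measure (Euc d)).toSphere

/-- The projection `P^θ(x) = ⟨x, θ⟩`. -/
def proj {d : ℕ} (θ : Metric.sphere (0 : Euc d) 1) (x : Euc d) : ℝ :=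
  inner ℝ x (θ : Euc d)

/-- The squared sliced-Wasserstein distance
`SW₂²(μ, ν) = ∫_{S^{d-1}} W₂²(P^θ_# μ, P^θ_# ν) dλ(θ)`. -/
def slicedWassersteinSq {d : ℕ} (μ ν : Measure (Euc d)) : ℝ≥0∞ :=
  ∫⁻ θ, wassersteinSq (μ.map (proj θ)) (ν.map (proj θ)) ∂(sphereUniform d)

/-- The objective of one step of the SW-JKO scheme from `ν`,
`μ ↦ SW₂²(μ, ν) / (2τ) + F(μ)`. (On compact `K` the sliced distance is finite, see
`slicedWassersteinSq_lt_top` below.) -/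
def objective {d : ℕ} {K : Set (Euc d)} (τ : ℝ) (F : P2 K → ℝ) (ν μ : P2 K) : ℝ :=
  (slicedWassersteinSq (toEuc μ) (toEuc ν)).toReal / (2 * τ) + F μ

/-- `μ` is a possible next iterate of the SW-JKO scheme from `ν`: it belongs to
`argmin_{ρ ∈ P₂(K)} SW₂²(ρ, ν) / (2τ) + F(ρ)`. -/
def IsStep {d : ℕ} {K : Set (Euc d)} (τ : ℝ) (F : P2 K → ℝ) (ν μ : P2 K) : Prop :=
  ∀ ρ : P2 K, objective τ F ν μ ≤ objective τ F ν ρ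

/-- The mixture `(1 - t) μ + t ν` of two probability measures. -/
def mix {d : ℕ} {K : Set (Euc d)} (t : unitInterval) (μ ν : P2 K) : P2 K :=
  ⟨ENNReal.ofReal (1 - t) • (μ : Measure K) + ENNReal.ofReal t • (ν : Measure K), ⟨by
    simp only [Measure.add_apply, Measure.smul_apply, measure_univ, smul_eq_mul, mul_one]
    rw [← ENNReal.ofReal_add (sub_nonneg.2 t.2.2) t.2.1]
    simp⟩⟩

/-- Convexity of a functional on `P₂(K)`, along mixtures of measures. -/
def IsConvex {d : ℕ} {K : Set (Euc d)} (F : P2 K → ℝ) : Prop :=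
  ∀ (μ ν : P2 K) (t : unitInterval), F (mix t μ ν) ≤ (1 - (t : ℝ)) * F μ + (t : ℝ) * F ν

/-- Strict convexity of a functional on `P₂(K)`, along mixtures of measures. -/
def IsStrictConvex {d : ℕ} {K : Set (Euc d)} (F : P2 K → ℝ) : Prop :=
  ∀ (μ ν : P2 K) (t : unitInterval), μ ≠ ν → 0 < t → t < 1 →
    F (mix t μ ν) < (1 - (t : ℝ)) * F μ + (t : ℝ) * F ν

instance {d : ℕ} {K : Set (Euc d)} (μ : P2 K) : IsProbabilityMeasure (toEuc μ) :=
  Measure.isProbabilityMeasure_map (by fun_prop)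

theorem measurable_proj {d : ℕ} (θ : Metric.sphere (0 : Euc d) 1) : Measurable (proj θ) := by
  unfold proj; fun_prop

theorem sphereUniform_univ_le (d : ℕ) : sphereUniform d Set.univ ≤ 1 := by
  simp only [sphereUniform, Measure.smul_apply, smul_eq_mul]
  exact ENNReal.inv_mul_le_one _

theorem isProbabilityMeasure_sphereUniform (d : ℕ) (hd : 0 < d) :
    IsProbabilityMeasure (sphereUniform d) := by
  have : Nonempty (Fin d) := ⟨⟨0, hd⟩⟩
  have h : (volume : Measure (Euc d)).toSphere ≠ 0 := by simp
  exact ⟨ENNReal.inv_mul_cancel (Measure.measure_univ_ne_zero.2 h) (measure_ne_top _ _)⟩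

/-- The sliced-Wasserstein distance of two measures on a compact set is finite, so that nothing is
lost in `objective`. -/
theorem slicedWassersteinSq_lt_top {d : ℕ} {K : Set (Euc d)} (hK : IsCompact K) (μ ν : P2 K) :
    slicedWassersteinSq (toEuc μ) (toEuc ν) < ∞ := by
  obtain ⟨R, hR⟩ := hK.isBounded.exists_norm_le
  have hproj : ∀ (ρ : P2 K) (θ : Metric.sphere (0 : Euc d) 1),
      ∀ᵐ x ∂((toEuc ρ).map (proj θ)), |x| ≤ R := by
    intro ρ θ
    rw [ae_map_iff (measurable_proj θ).aemeasurable
      (measurableSet_le (by fun_prop) (by fun_prop)), toEuc,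
      ae_map_iff (p := fun x => |proj θ x| ≤ R) (by fun_prop)
        (measurableSet_le (measurable_proj θ).norm measurable_const)]
    refine Filter.Eventually.of_forall fun x => ?_
    have h1 := abs_real_inner_le_norm (x : Euc d) (θ : Euc d)
    have h2 : ‖(θ : Euc d)‖ = 1 := by simp
    rw [h2, mul_one] at h1
    exact h1.trans (hR x x.2)
  have hW : ∀ θ : Metric.sphere (0 : Euc d) 1,
      wassersteinSq ((toEuc μ).map (proj θ)) ((toEuc ν).map (proj θ))
        ≤ ENNReal.ofReal (2 * R) ^ 2 := by
    intro θ
    have i1 := Measure.isProbabilityMeasure_map (μ := toEuc μ) (measurable_proj θ).aemeasurable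
    have i2 := Measure.isProbabilityMeasure_map (μ := toEuc ν) (measurable_proj θ).aemeasurable
    set a := (toEuc μ).map (proj θ)
    set b := (toEuc ν).map (proj θ)
    refine (iInf₂_le (a.prod b) ⟨by simp [Measure.fst_prod], by simp [Measure.snd_prod]⟩).trans ?_
    have hae : ∀ᵐ p ∂(a.prod b), edist p.1 p.2 ^ 2 ≤ ENNReal.ofReal (2 * R) ^ 2 := by
      have e1 : ∀ᵐ p ∂(a.prod b), |p.1| ≤ R :=
        Measure.quasiMeasurePreserving_fst.ae (hproj μ θ)
      have e2 : ∀ᵐ p ∂(a.prod b), |p.2| ≤ R :=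
        Measure.quasiMeasurePreserving_snd.ae (hproj ν θ)
      filter_upwards [e1, e2] with p h1 h2
      rw [edist_dist, Real.dist_eq]
      gcongr
      have := abs_sub p.1 p.2
      linarith
    calc _ ≤ ∫⁻ _, ENNReal.ofReal (2 * R) ^ 2 ∂(a.prod b) := lintegral_mono_ae hae
      _ = _ := by simp
  calc slicedWassersteinSq (toEuc μ) (toEuc ν)
      ≤ ∫⁻ _, ENNReal.ofReal (2 * R) ^ 2 ∂(sphereUniform d) := lintegral_mono hW
    _ = ENNReal.ofReal (2 * R) ^ 2 * sphereUniform d Set.univ := by simp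
    _ ≤ ENNReal.ofReal (2 * R) ^ 2 * 1 := by gcongr; exact sphereUniform_univ_le d
    _ < ∞ := by rw [mul_one]; exact ENNReal.pow_lt_top ENNReal.ofReal_lt_top

end SWJKO

end

namespace SWJKO

open Set Filter ProbabilityTheory Topology

/-! The key is a formula for `W₂²` on the line that is visibly convex in each measure. The number
`|x - y|²` is the area of the square with side between `x` and `y`, so Tonelli writes the cost of a
coupling as an integral over the plane of its masses on quadrants `Iic a ×ˢ Ioi b` and `Ioi b ×ˢ Iic
a`. The marginals bound these masses below by truncated differences of distribution functions, and
the quantile coupling attains all the bounds at once (`wassersteinSq_eq_lintegral_cdfCost`).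

Existence: weak convergence gives convergence of distribution functions off atoms, so Fatou makes
`SW₂²` lower semicontinuous on the compact space `P2 K`.

Uniqueness: distribution functions are affine under mixtures and truncated subtraction is convex, so
`SW₂²` is convex. If the reference measure has a density, its projections are atomless, and equality
in convexity forces equal projections in almost every direction (`eq_of_ae_cdfCost_mix_eq`), hence
equal measures by Cramér–Wold (`eq_of_ae_projMeasure_eq`). -/

/-! ### Quantile functions and the comonotone coupling. -/

/-- The quantile function of a probability measure on the line. -/
noncomputable def quantile (μ : Measure ℝ) (s : ℝ) : ℝ := sInf {x | s ≤ cdf μ x}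

/-- Right-continuity of the distribution function makes the infimum attained; the open interval
makes the set nonempty and bounded below. -/
theorem quantile_le_iff (μ : Measure ℝ) {s : ℝ} (hs : s ∈ Ioo (0 : ℝ) 1) (a : ℝ) :
    quantile μ s ≤ a ↔ s ≤ cdf μ a := by
  have hbdd : BddBelow {x | s ≤ cdf μ x} := by
    obtain ⟨b, hb⟩ := ((tendsto_cdf_atBot μ).eventually (gt_mem_nhds hs.1)).exists
    refine ⟨b, fun x hx => ?_⟩
    by_contra! h
    exact absurd (hx.trans (monotone_cdf μ h.le)) (not_le.2 hb)
  have hne : {x | s ≤ cdf μ x}.Nonempty := by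
    obtain ⟨b, hb⟩ := ((tendsto_cdf_atTop μ).eventually (lt_mem_nhds hs.2)).exists
    exact ⟨b, hb.le⟩
  refine ⟨fun h => ?_, fun h => csInf_le hbdd h⟩
  refine le_of_tendsto_of_tendsto tendsto_const_nhds
    (((cdf μ).right_continuous a).mono_left (nhdsWithin_mono a Ioi_subset_Ici_self))
    (eventually_nhdsWithin_of_forall fun x hx => ?_)
  obtain ⟨y, hy, hyx⟩ := exists_lt_of_csInf_lt hne (lt_of_le_of_lt h hx)
  exact le_trans hy (monotone_cdf μ hyx.le)

theorem aemeasurable_quantile (μ : Measure ℝ) :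
    AEMeasurable (quantile μ) (volume.restrict (Ioo (0 : ℝ) 1)) :=
  aemeasurable_restrict_of_monotoneOn measurableSet_Ioo fun _ hs _ ht hst =>
    (quantile_le_iff μ hs _).2 (hst.trans ((quantile_le_iff μ ht _).1 le_rfl))

/-- The comonotone coupling of two measures on the line. -/
noncomputable def quantileCoupling (μ ν : Measure ℝ) : Measure (ℝ × ℝ) :=
  (volume.restrict (Ioo (0 : ℝ) 1)).map fun s => (quantile μ s, quantile ν s)

theorem volume_Ioo_inter_Iic {c : ℝ} (hc : c ≤ 1) :
    volume (Ioo (0 : ℝ) 1 ∩ Iic c) = ENNReal.ofReal c := by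
  apply le_antisymm
  · calc _ ≤ volume (Ioc (0 : ℝ) c) := measure_mono fun x hx => ⟨hx.1.1, hx.2⟩
      _ = _ := by simp
  · calc _ = volume (Ioo (0 : ℝ) c) := by simp
      _ ≤ volume (Ioo (0 : ℝ) 1 ∩ Iic c) :=
        measure_mono fun x hx => ⟨⟨hx.1, hx.2.trans_le hc⟩, hx.2.le⟩

/-- Both coordinates are driven by the same `s`, so the two constraints say that `s` is below the
smaller of the two distribution values. -/
theorem quantileCoupling_apply (μ ν : Measure ℝ) [IsProbabilityMeasure μ]
    [IsProbabilityMeasure ν] (a b : ℝ) :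
    quantileCoupling μ ν (Iic a ×ˢ Iic b) = min (μ (Iic a)) (ν (Iic b)) := by
  have hae := (aemeasurable_quantile μ).prodMk (aemeasurable_quantile ν)
  rw [quantileCoupling, Measure.map_apply_of_aemeasurable hae (measurableSet_Iic.prod measurableSet_Iic),
    Measure.restrict_apply' measurableSet_Ioo, ← ofReal_cdf μ, ← ofReal_cdf ν,
    ← ENNReal.ofReal_min,
    ← volume_Ioo_inter_Iic (min_le_of_left_le (cdf_le_one μ a))]
  congr 1
  ext s
  simp only [mem_inter_iff, mem_preimage, mem_prod, mem_Iic, le_min_iff]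
  constructor
  · rintro ⟨⟨h1, h2⟩, hs⟩
    exact ⟨hs, (quantile_le_iff μ hs a).1 h1, (quantile_le_iff ν hs b).1 h2⟩
  · rintro ⟨hs, h1, h2⟩
    exact ⟨⟨(quantile_le_iff μ hs a).2 h1, (quantile_le_iff ν hs b).2 h2⟩, hs⟩

theorem map_quantile (μ : Measure ℝ) [IsProbabilityMeasure μ] :
    (volume.restrict (Ioo (0 : ℝ) 1)).map (quantile μ) = μ := by
  have : IsFiniteMeasure ((volume.restrict (Ioo (0 : ℝ) 1)).map (quantile μ)) := inferInstance
  refine Measure.ext_of_Iic _ _ fun a => ?_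
  rw [Measure.map_apply_of_aemeasurable (aemeasurable_quantile μ) measurableSet_Iic,
    Measure.restrict_apply' measurableSet_Ioo, ← ofReal_cdf μ,
    ← volume_Ioo_inter_Iic (cdf_le_one μ a)]
  congr 1
  ext s
  simp only [mem_inter_iff, mem_preimage, mem_Iic]
  exact ⟨fun h => ⟨h.2, (quantile_le_iff μ h.2 a).1 h.1⟩,
    fun h => ⟨(quantile_le_iff μ h.1 a).2 h.2, h.1⟩⟩

theorem isCoupling_quantileCoupling (μ ν : Measure ℝ) [IsProbabilityMeasure μ]
    [IsProbabilityMeasure ν] : IsCoupling (quantileCoupling μ ν) μ ν := by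
  have hae := (aemeasurable_quantile μ).prodMk (aemeasurable_quantile ν)
  constructor
  · rw [Measure.fst, quantileCoupling, AEMeasurable.map_map_of_aemeasurable (by fun_prop) hae]
    exact map_quantile μ
  · rw [Measure.snd, quantileCoupling, AEMeasurable.map_map_of_aemeasurable (by fun_prop) hae]
    exact map_quantile ν

/-! ### The transport cost on the line through distribution functions. -/

/-- The density, on the plane, of the transport cost between two measures on the line, in terms of
their distribution functions. -/
noncomputable def cdfCost (μ ν : Measure ℝ) (p : ℝ × ℝ) : ℝ≥0∞ :=
  (μ (Iic (min p.1 p.2)) - ν (Iic (max p.1 p.2))) +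
    (ν (Iic (min p.1 p.2)) - μ (Iic (max p.1 p.2)))

/-- The two squares cover the two orders of `x` and `y`; one is always empty. Half-open sides match
`Iic` and its complement `Ioi`. -/
theorem edist_sq_eq_lintegral (x y : ℝ) :
    edist x y ^ 2 = ∫⁻ p : ℝ × ℝ, (Ico x y ×ˢ Ico x y).indicator 1 p
      + (Ico y x ×ˢ Ico y x).indicator 1 p := by
  have hm : ∀ a b : ℝ, MeasurableSet (Ico a b ×ˢ Ico a b) :=
    fun a b => measurableSet_Ico.prod measurableSet_Ico
  rw [lintegral_add_left (measurable_one.indicator (hm x y)), lintegral_indicator_one (hm x y),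
    lintegral_indicator_one (hm y x), Measure.volume_eq_prod, Measure.prod_prod, Measure.prod_prod,
    Real.volume_Ico, Real.volume_Ico, edist_dist, Real.dist_eq]
  rcases le_total x y with h | h
  · rw [ENNReal.ofReal_of_nonpos (sub_nonpos.2 h), abs_sub_comm, abs_of_nonneg (sub_nonneg.2 h)]
    ring
  · rw [ENNReal.ofReal_of_nonpos (sub_nonpos.2 h), abs_of_nonneg (sub_nonneg.2 h)]
    ring

theorem lintegral_edist_sq (π : Measure (ℝ × ℝ)) [SFinite π] :
    ∫⁻ z, edist z.1 z.2 ^ 2 ∂π = ∫⁻ p : ℝ × ℝ, π (Iic (min p.1 p.2) ×ˢ Ioi (max p.1 p.2))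
      + π (Ioi (max p.1 p.2) ×ˢ Iic (min p.1 p.2)) := by
  have e1 : ∀ z p : ℝ × ℝ, (Ico z.1 z.2 ×ˢ Ico z.1 z.2).indicator (1 : ℝ × ℝ → ℝ≥0∞) p
      = (Iic (min p.1 p.2) ×ˢ Ioi (max p.1 p.2)).indicator 1 z := by
    intro z p
    simp only [indicator, mem_prod, mem_Ico, mem_Iic, mem_Ioi, le_min_iff, max_lt_iff, Pi.one_apply]
    congr 1
    exact propext (by tauto)
  have e2 : ∀ z p : ℝ × ℝ, (Ico z.2 z.1 ×ˢ Ico z.2 z.1).indicator (1 : ℝ × ℝ → ℝ≥0∞) p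
      = (Ioi (max p.1 p.2) ×ˢ Iic (min p.1 p.2)).indicator 1 z := by
    intro z p
    simp only [indicator, mem_prod, mem_Ico, mem_Iic, mem_Ioi, le_min_iff, max_lt_iff, Pi.one_apply]
    congr 1
    exact propext (by tauto)
  have m1 : MeasurableSet
      {q : (ℝ × ℝ) × (ℝ × ℝ) | q.1 ∈ Iic (min q.2.1 q.2.2) ×ˢ Ioi (max q.2.1 q.2.2)} :=
    (measurableSet_le (by fun_prop) (by fun_prop)).inter
      (measurableSet_lt (by fun_prop) (by fun_prop))
  have m2 : MeasurableSet
      {q : (ℝ × ℝ) × (ℝ × ℝ) | q.1 ∈ Ioi (max q.2.1 q.2.2) ×ˢ Iic (min q.2.1 q.2.2)} :=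
    (measurableSet_lt (by fun_prop) (by fun_prop)).inter
      (measurableSet_le (by fun_prop) (by fun_prop))
  simp_rw [edist_sq_eq_lintegral, e1, e2]
  rw [lintegral_lintegral_swap]
  · refine lintegral_congr fun p => ?_
    rw [lintegral_add_left (measurable_one.indicator (measurableSet_Iic.prod measurableSet_Ioi)),
      lintegral_indicator_one (measurableSet_Iic.prod measurableSet_Ioi),
      lintegral_indicator_one (measurableSet_Ioi.prod measurableSet_Iic)]
  · exact ((measurable_one.indicator m1).add (measurable_one.indicator m2)).aemeasurable

/-- The quadrant is the event "first coordinate at most `a`" minus "second at most `b`", and its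
mass is at least the difference of the marginal masses. -/
theorem le_measure_Iic_prod_Ioi {π : Measure (ℝ × ℝ)} {μ ν : Measure ℝ} (h : IsCoupling π μ ν)
    (a b : ℝ) : μ (Iic a) - ν (Iic b) ≤ π (Iic a ×ˢ Ioi b) := by
  rw [← h.1, ← h.2, Measure.fst_apply measurableSet_Iic, Measure.snd_apply measurableSet_Iic]
  refine le_measure_sdiff.trans (measure_mono fun z hz => ?_)
  exact ⟨hz.1, mem_Ioi.2 (not_le.1 hz.2)⟩

theorem le_measure_Ioi_prod_Iic {π : Measure (ℝ × ℝ)} {μ ν : Measure ℝ} (h : IsCoupling π μ ν)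
    (a b : ℝ) : ν (Iic a) - μ (Iic b) ≤ π (Ioi b ×ˢ Iic a) := by
  rw [← h.1, ← h.2, Measure.fst_apply measurableSet_Iic, Measure.snd_apply measurableSet_Iic]
  refine le_measure_sdiff.trans (measure_mono fun z hz => ?_)
  exact ⟨mem_Ioi.2 (not_le.1 hz.2), hz.1⟩

theorem IsCoupling.isProbabilityMeasure {π : Measure (ℝ × ℝ)} {μ ν : Measure ℝ}
    [IsProbabilityMeasure μ] (h : IsCoupling π μ ν) : IsProbabilityMeasure π :=
  ⟨by rw [← Measure.fst_univ, h.1, measure_univ]⟩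

/-- Comonotonicity nests the two events, which turns the general lower bound into an equality. -/
theorem quantileCoupling_Iic_prod_Ioi (μ ν : Measure ℝ) [IsProbabilityMeasure μ]
    [IsProbabilityMeasure ν] (a b : ℝ) :
    quantileCoupling μ ν (Iic a ×ˢ Ioi b) = μ (Iic a) - ν (Iic b) := by
  have h := isCoupling_quantileCoupling μ ν
  have := h.isProbabilityMeasure
  have e : Iic a ×ˢ Ioi b = (Prod.fst ⁻¹' Iic a) \ (Iic a ×ˢ Iic b) := by
    ext z
    simp only [mem_prod, mem_Iic, mem_Ioi, Set.mem_sdiff, mem_preimage, not_and, not_le]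
    tauto
  rw [e, measure_sdiff (show Iic a ×ˢ Iic b ⊆ Prod.fst ⁻¹' Iic a from fun z hz => hz.1)
    (measurableSet_Iic.prod measurableSet_Iic).nullMeasurableSet
    (measure_ne_top _ _), ← Measure.fst_apply measurableSet_Iic, h.1, quantileCoupling_apply]
  rcases le_total (μ (Iic a)) (ν (Iic b)) with h' | h'
  · rw [min_eq_left h', tsub_self, tsub_eq_zero_of_le h']
  · rw [min_eq_right h']

theorem quantileCoupling_Ioi_prod_Iic (μ ν : Measure ℝ) [IsProbabilityMeasure μ]
    [IsProbabilityMeasure ν] (a b : ℝ) :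
    quantileCoupling μ ν (Ioi b ×ˢ Iic a) = ν (Iic a) - μ (Iic b) := by
  have h := isCoupling_quantileCoupling μ ν
  have := h.isProbabilityMeasure
  have e : Ioi b ×ˢ Iic a = (Prod.snd ⁻¹' Iic a) \ (Iic b ×ˢ Iic a) := by
    ext z
    simp only [mem_prod, mem_Iic, mem_Ioi, Set.mem_sdiff, mem_preimage, ← not_le]
    tauto
  rw [e, measure_sdiff (show Iic b ×ˢ Iic a ⊆ Prod.snd ⁻¹' Iic a from fun z hz => hz.2)
    (measurableSet_Iic.prod measurableSet_Iic).nullMeasurableSet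
    (measure_ne_top _ _), ← Measure.snd_apply measurableSet_Iic, h.2, quantileCoupling_apply]
  rcases le_total (μ (Iic b)) (ν (Iic a)) with h' | h'
  · rw [min_eq_left h']
  · rw [min_eq_right h', tsub_self, tsub_eq_zero_of_le h']

/-- The squared Wasserstein distance on the line, in terms of distribution functions. -/
theorem wassersteinSq_eq_lintegral_cdfCost (μ ν : Measure ℝ) [IsProbabilityMeasure μ]
    [IsProbabilityMeasure ν] : wassersteinSq μ ν = ∫⁻ p, cdfCost μ ν p := by
  apply le_antisymm
  · have h := isCoupling_quantileCoupling μ ν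
    have := h.isProbabilityMeasure
    refine (iInf₂_le (quantileCoupling μ ν) h).trans_eq ?_
    rw [lintegral_edist_sq]
    simp_rw [quantileCoupling_Ioi_prod_Iic, quantileCoupling_Iic_prod_Ioi]
    rfl
  · refine le_iInf₂ fun π h => ?_
    have := h.isProbabilityMeasure
    rw [lintegral_edist_sq]
    exact lintegral_mono fun p =>
      add_le_add (le_measure_Iic_prod_Ioi h _ _) (le_measure_Ioi_prod_Iic h _ _)

/-! ### The sliced cost as one integral over directions and heights. -/

variable {d : ℕ} {K : Set (Euc d)}

instance (d : ℕ) : IsFiniteMeasure (sphereUniform d) :=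
  ⟨(sphereUniform_univ_le d).trans_lt ENNReal.one_lt_top⟩

/-- The projection of a probability measure on `K` to the line spanned by `θ`. -/
noncomputable def projMeasure (μ : P2 K) (θ : Metric.sphere (0 : Euc d) 1) : Measure ℝ :=
  (toEuc μ).map (proj θ)

instance (μ : P2 K) (θ : Metric.sphere (0 : Euc d) 1) :
    IsProbabilityMeasure (projMeasure μ θ) :=
  Measure.isProbabilityMeasure_map (measurable_proj θ).aemeasurable

theorem measurable_projMeasure_Iic (μ : P2 K) :
    Measurable fun q : Metric.sphere (0 : Euc d) 1 × ℝ => projMeasure μ q.1 (Iic q.2) := by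
  have hm : MeasurableSet {z : (Metric.sphere (0 : Euc d) 1 × ℝ) × Euc d |
      inner ℝ z.2 (z.1.1 : Euc d) ≤ z.1.2} := by
    refine measurableSet_le (Measurable.inner ?_ ?_) ?_ <;> fun_prop
  have e : (fun q : Metric.sphere (0 : Euc d) 1 × ℝ => projMeasure μ q.1 (Iic q.2))
      = fun q => toEuc μ (Prod.mk q ⁻¹' {z : (Metric.sphere (0 : Euc d) 1 × ℝ) × Euc d |
        inner ℝ z.2 (z.1.1 : Euc d) ≤ z.1.2}) := by
    funext q
    rw [projMeasure, Measure.map_apply (measurable_proj _) measurableSet_Iic]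
    rfl
  rw [e]
  exact measurable_measure_prodMk_left hm

/-- The density of the sliced transport cost, as a function of the direction and of two heights. -/
noncomputable def slicedCost (μ ν : P2 K) (q : Metric.sphere (0 : Euc d) 1 × (ℝ × ℝ)) : ℝ≥0∞ :=
  cdfCost (projMeasure μ q.1) (projMeasure ν q.1) q.2

theorem measurable_slicedCost (μ ν : P2 K) : Measurable (slicedCost μ ν) := by
  have mmin : Measurable fun q : Metric.sphere (0 : Euc d) 1 × (ℝ × ℝ) =>
      (q.1, min q.2.1 q.2.2) :=
    measurable_fst.prodMk (measurable_snd.fst.min measurable_snd.snd)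
  have hmin : ∀ ρ : P2 K, Measurable fun q : Metric.sphere (0 : Euc d) 1 × (ℝ × ℝ) =>
      projMeasure ρ q.1 (Iic (min q.2.1 q.2.2)) := by
    intro ρ
    simpa only [Function.comp_def] using (measurable_projMeasure_Iic ρ).comp mmin
  have mmax : Measurable fun q : Metric.sphere (0 : Euc d) 1 × (ℝ × ℝ) =>
      (q.1, max q.2.1 q.2.2) :=
    measurable_fst.prodMk (measurable_snd.fst.max measurable_snd.snd)
  have hmax : ∀ ρ : P2 K, Measurable fun q : Metric.sphere (0 : Euc d) 1 × (ℝ × ℝ) =>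
      projMeasure ρ q.1 (Iic (max q.2.1 q.2.2)) := by
    intro ρ
    simpa only [Function.comp_def] using (measurable_projMeasure_Iic ρ).comp mmax
  exact ((hmin μ).sub (hmax ν)).add ((hmin ν).sub (hmax μ))

theorem slicedWassersteinSq_eq_lintegral (μ ν : P2 K) :
    slicedWassersteinSq (toEuc μ) (toEuc ν)
      = ∫⁻ q, slicedCost μ ν q ∂((sphereUniform d).prod volume) := by
  rw [lintegral_prod _ (measurable_slicedCost μ ν).aemeasurable]
  exact lintegral_congr fun θ =>
    wassersteinSq_eq_lintegral_cdfCost (projMeasure μ θ) (projMeasure ν θ)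

/-! ### Lower semicontinuity and existence of a minimizer. -/

theorem ae_measure_singleton_eq_zero (μ : Measure ℝ) [SFinite μ] : ∀ᵐ u : ℝ, μ {u} = 0 := by
  have h : {t : ℝ | 0 < μ {a | id a = t}}.Countable :=
    Measure.countable_meas_level_set_pos measurable_id
  filter_upwards [h.ae_notMem volume] with u hu
  simpa using hu

/-- Portmanteau: the frontier of `Iic u` is `{u}`, which is null by assumption. -/
theorem tendsto_projMeasure_Iic {ι : Type*} {l : Filter ι} {μs : ι → P2 K} {μ : P2 K}
    (h : Tendsto μs l (𝓝 μ)) (θ : Metric.sphere (0 : Euc d) 1) {u : ℝ}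
    (hu : projMeasure μ θ {u} = 0) :
    Tendsto (fun i => projMeasure (μs i) θ (Iic u)) l (𝓝 (projMeasure μ θ (Iic u))) := by
  have hc : Continuous fun x : K => proj θ (x : Euc d) := by unfold proj; fun_prop
  have e : ∀ ρ : P2 K, ((ρ.map hc.measurable.aemeasurable : ProbabilityMeasure ℝ) : Measure ℝ)
      = projMeasure ρ θ := by
    intro ρ
    rw [projMeasure, toEuc, Measure.map_map (measurable_proj θ) measurable_subtype_coe]
    rfl
  have := ProbabilityMeasure.tendsto_measure_of_null_frontier_of_tendsto'
    (ProbabilityMeasure.tendsto_map_of_tendsto_of_continuous μs μ h hc) (E := Iic u)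
    (by rw [frontier_Iic, e]; exact hu)
  simpa only [e] using this

theorem ae_tendsto_cdfCost {ι : Type*} {l : Filter ι} {μs : ι → P2 K} {μ : P2 K}
    (h : Tendsto μs l (𝓝 μ)) (ν : P2 K) (θ : Metric.sphere (0 : Euc d) 1) :
    ∀ᵐ p : ℝ × ℝ, Tendsto (fun i => slicedCost (μs i) ν (θ, p)) l (𝓝 (slicedCost μ ν (θ, p))) := by
  have h0 := ae_measure_singleton_eq_zero (projMeasure μ θ)
  have h1 : ∀ᵐ p : ℝ × ℝ, projMeasure μ θ {p.1} = 0 :=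
    Measure.quasiMeasurePreserving_fst.ae h0
  have h2 : ∀ᵐ p : ℝ × ℝ, projMeasure μ θ {p.2} = 0 :=
    Measure.quasiMeasurePreserving_snd.ae h0
  filter_upwards [h1, h2] with p hp1 hp2
  have hmin : projMeasure μ θ {min p.1 p.2} = 0 := by
    rcases min_choice p.1 p.2 with h | h <;> rwa [h]
  have hmax : projMeasure μ θ {max p.1 p.2} = 0 := by
    rcases max_choice p.1 p.2 with h | h <;> rwa [h]
  exact (ENNReal.Tendsto.sub (tendsto_projMeasure_Iic h θ hmin) tendsto_const_nhds
      (Or.inr (measure_ne_top _ _))).add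
    (ENNReal.Tendsto.sub tendsto_const_nhds (tendsto_projMeasure_Iic h θ hmax)
      (Or.inl (measure_ne_top _ _)))

theorem slicedWassersteinSq_le_liminf {μs : ℕ → P2 K} {μ : P2 K}
    (h : Tendsto μs atTop (𝓝 μ)) (ν : P2 K) :
    slicedWassersteinSq (toEuc μ) (toEuc ν)
      ≤ liminf (fun n => slicedWassersteinSq (toEuc (μs n)) (toEuc ν)) atTop := by
  simp_rw [slicedWassersteinSq_eq_lintegral]
  refine le_trans (le_of_eq ?_) (lintegral_liminf_le fun n => measurable_slicedCost (μs n) ν)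
  have hm : Measurable fun q => liminf (fun n => slicedCost (μs n) ν q) atTop :=
    Measurable.liminf fun n => measurable_slicedCost (μs n) ν
  -- The null set where convergence fails depends on `θ`; integrating one direction at a time avoids
  -- its joint measurability.
  rw [lintegral_prod _ (measurable_slicedCost μ ν).aemeasurable,
    lintegral_prod _ hm.aemeasurable]
  refine lintegral_congr fun θ => lintegral_congr_ae ?_
  filter_upwards [ae_tendsto_cdfCost h ν θ] with p hp using hp.liminf_eq.symm

theorem lowerSemicontinuous_slicedWassersteinSq (ν : P2 K) :
    LowerSemicontinuous fun μ : P2 K => slicedWassersteinSq (toEuc μ) (toEuc ν) := by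
  rw [lowerSemicontinuous_iff_isClosed_preimage]
  intro y
  -- The weak topology on `P2 K` is sequential, so sublevel sets may be tested on sequences, as
  -- Fatou requires.
  refine IsSeqClosed.isClosed fun μs μ hμs h => ?_
  refine (slicedWassersteinSq_le_liminf h ν).trans ?_
  exact liminf_le_of_le (by isBoundedDefault) fun b hb => by
    obtain ⟨n, hn⟩ := hb.exists
    exact hn.trans (hμs n)

theorem lowerSemicontinuous_objective (hK : IsCompact K) {F : P2 K → ℝ}
    (hF : LowerSemicontinuous F) {τ : ℝ} (hτ : 0 < τ) (ν : P2 K) :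
    LowerSemicontinuous (objective τ F ν) := by
  refine LowerSemicontinuous.add (fun μ y hy => ?_) hF
  have hfin := fun ρ : P2 K => (slicedWassersteinSq_lt_top hK ρ ν).ne
  rcases lt_or_ge y 0 with h0 | h0
  · exact Eventually.of_forall fun ρ => h0.trans_le (by positivity)
  · have h2 : 0 < 2 * τ := by positivity
    replace hy : y < (slicedWassersteinSq (toEuc μ) (toEuc ν)).toReal / (2 * τ) := hy
    rw [lt_div_iff₀ h2, ← ENNReal.ofReal_lt_iff_lt_toReal (by positivity) (hfin μ)] at hy
    filter_upwards [lowerSemicontinuous_slicedWassersteinSq ν μ _ hy] with ρ hρ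
    change y < (slicedWassersteinSq (toEuc ρ) (toEuc ν)).toReal / (2 * τ)
    rwa [lt_div_iff₀ h2, ← ENNReal.ofReal_lt_iff_lt_toReal (by positivity) (hfin ρ)]

theorem exists_isStep (hK : IsCompact K) {F : P2 K → ℝ} (hF : LowerSemicontinuous F) {τ : ℝ}
    (hτ : 0 < τ) (ν : P2 K) : ∃ μ : P2 K, IsStep τ F ν μ := by
  have : CompactSpace K := isCompact_iff_compactSpace.1 hK
  obtain ⟨μ, -, hμ⟩ := LowerSemicontinuousOn.exists_isMinOn (s := univ) ⟨ν, mem_univ ν⟩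
    isCompact_univ ((lowerSemicontinuous_objective hK hF hτ ν).lowerSemicontinuousOn univ)
  exact ⟨μ, fun ρ => hμ (mem_univ ρ)⟩

/-! ### Convexity of truncated differences and of the cost along mixtures. -/

section Truncation

variable {s t a b c : ℝ≥0∞}

theorem mix_tsub_le (hst : s + t = 1) (a b c : ℝ≥0∞) :
    s * a + t * b - c ≤ s * (a - c) + t * (b - c) := by
  rw [tsub_le_iff_right]
  calc s * a + t * b ≤ s * (a - c + c) + t * (b - c + c) := by gcongr <;> exact le_tsub_add
    _ = s * (a - c) + t * (b - c) + (s + t) * c := by ring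
    _ = _ := by rw [hst, one_mul]

theorem tsub_mix_le (hst : s + t = 1) (a b c : ℝ≥0∞) :
    c - (s * a + t * b) ≤ s * (c - a) + t * (c - b) := by
  rw [tsub_le_iff_right]
  calc c = s * c + t * c := by rw [← add_mul, hst, one_mul]
    _ ≤ s * (c - a + a) + t * (c - b + b) := by gcongr <;> exact le_tsub_add
    _ = _ := by ring

/-- Strictness comes from the kink of `x ↦ x - c` at `c`, which lies strictly between `b` and `a`.
-/
theorem mix_tsub_lt (hst : s + t = 1) (hs : s ≠ 0) (ht : t ≠ 0) (ha : a ≠ ∞) (hbc : b < c)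
    (hca : c < a) : s * a + t * b - c < s * (a - c) + t * (b - c) := by
  have hs' : s ≠ ∞ := ne_top_of_le_ne_top ENNReal.one_ne_top (hst ▸ le_self_add)
  have ht' : t ≠ ∞ := ne_top_of_le_ne_top ENNReal.one_ne_top (hst ▸ le_add_self)
  rw [tsub_eq_zero_of_le hbc.le, mul_zero, add_zero]
  rcases le_total (s * a + t * b) c with h | h
  · rw [tsub_eq_zero_of_le h]
    exact ENNReal.mul_pos hs (tsub_pos_of_lt hca).ne'
  · rw [ENNReal.sub_lt_iff_lt_right hca.ne_top h]
    calc s * a + t * b < s * a + t * c :=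
          ENNReal.add_lt_add_left (ENNReal.mul_ne_top hs' ha)
            ((ENNReal.mul_lt_mul_iff_right ht ht').2 hbc)
      _ = s * (a - c + c) + t * c := by rw [tsub_add_cancel_of_le hca.le]
      _ = s * (a - c) + (s + t) * c := by ring
      _ = _ := by rw [hst, one_mul]

theorem tsub_mix_lt (hst : s + t = 1) (hs : s ≠ 0) (ht : t ≠ 0) (hbc : b < c)
    (hca : c < a) : c - (s * a + t * b) < s * (c - a) + t * (c - b) := by
  have hs' : s ≠ ∞ := ne_top_of_le_ne_top ENNReal.one_ne_top (hst ▸ le_self_add)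
  have ht' : t ≠ ∞ := ne_top_of_le_ne_top ENNReal.one_ne_top (hst ▸ le_add_self)
  rw [tsub_eq_zero_of_le hca.le, mul_zero, zero_add]
  rcases le_total c (s * a + t * b) with h | h
  · rw [tsub_eq_zero_of_le h]
    exact ENNReal.mul_pos ht (tsub_pos_of_lt hbc).ne'
  · rw [ENNReal.sub_lt_iff_lt_right (ne_top_of_le_ne_top hca.ne_top h) h]
    calc c = s * c + t * c := by rw [← add_mul, hst, one_mul]
      _ < s * a + t * c := by
          refine ENNReal.add_lt_add_right (ENNReal.mul_ne_top ht' hca.ne_top) ?_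
          exact (ENNReal.mul_lt_mul_iff_right hs hs').2 hca
      _ = s * a + t * (c - b + b) := by rw [tsub_add_cancel_of_le hbc.le]
      _ = _ := by ring

end Truncation

theorem cdfCost_mix_le (μ₁ μ₂ ν : Measure ℝ) {s t : ℝ≥0∞} (hst : s + t = 1) (p : ℝ × ℝ) :
    cdfCost (s • μ₁ + t • μ₂) ν p ≤ s * cdfCost μ₁ ν p + t * cdfCost μ₂ ν p := by
  simp only [cdfCost, Measure.add_apply, Measure.smul_apply, smul_eq_mul]
  refine (add_le_add (mix_tsub_le hst _ _ _) (tsub_mix_le hst _ _ _)).trans_eq ?_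
  ring

/-- The order of `u` and `v` decides which of the two truncated differences compares `Iic u` with
`Iic v`; that one is strict, the other only convex. -/
theorem cdfCost_mix_lt (μ₁ μ₂ ν : Measure ℝ) [IsProbabilityMeasure μ₁] [IsProbabilityMeasure μ₂]
    [IsProbabilityMeasure ν] {s t : ℝ≥0∞} (hst : s + t = 1) (hs : s ≠ 0) (ht : t ≠ 0) {u v : ℝ}
    (h2 : μ₂ (Iic u) < ν (Iic v)) (h1 : ν (Iic v) < μ₁ (Iic u)) :
    cdfCost (s • μ₁ + t • μ₂) ν (u, v) < s * cdfCost μ₁ ν (u, v) + t * cdfCost μ₂ ν (u, v) := by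
  have hs' : s ≠ ∞ := ne_top_of_le_ne_top ENNReal.one_ne_top (hst ▸ le_self_add)
  have ht' : t ≠ ∞ := ne_top_of_le_ne_top ENNReal.one_ne_top (hst ▸ le_add_self)
  simp only [cdfCost, Measure.add_apply, Measure.smul_apply, smul_eq_mul]
  rcases le_total u v with h | h
  · rw [min_eq_left h, max_eq_right h]
    refine (ENNReal.add_lt_add_of_lt_of_le (ne_top_of_le_ne_top (measure_ne_top ν (Iic u)) tsub_le_self)
      (mix_tsub_lt hst hs ht (measure_ne_top _ _) h2 h1) (tsub_mix_le hst _ _ _)).trans_eq ?_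
    ring
  · rw [min_eq_right h, max_eq_left h]
    refine (ENNReal.add_lt_add_of_le_of_lt (ne_top_of_le_ne_top ?_ tsub_le_self)
      (mix_tsub_le hst _ _ _) (tsub_mix_lt hst hs ht h2 h1)).trans_eq ?_
    · exact ENNReal.add_ne_top.2 ⟨ENNReal.mul_ne_top hs' (measure_ne_top _ _),
        ENNReal.mul_ne_top ht' (measure_ne_top _ _)⟩
    · ring

/-! ### Strict convexity against an atomless measure. -/

theorem continuous_cdf (ν : Measure ℝ) [IsProbabilityMeasure ν] (hν : ∀ u, ν {u} = 0) :
    Continuous (cdf ν) := by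
  refine continuous_iff_continuousAt.2 fun x => ?_
  rw [(monotone_cdf ν).continuousAt_iff_leftLim_eq_rightLim, StieltjesFunction.rightLim_eq]
  refine le_antisymm ((monotone_cdf ν).leftLim_le le_rfl) ?_
  have h := hν x
  rw [← measure_cdf ν, StieltjesFunction.measure_singleton, ENNReal.ofReal_eq_zero] at h
  linarith

/-- Were it to fail at `u`, there would be a nonempty open rectangle of points `(x, v)` with `cdf ν
v` strictly between `cdf μ₂ x` and `cdf μ₁ x`, where convexity is strict. -/
theorem cdf_le_cdf_of_ae_eq (μ₁ μ₂ ν : Measure ℝ) [IsProbabilityMeasure μ₁]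
    [IsProbabilityMeasure μ₂] [IsProbabilityMeasure ν] (hν : ∀ u, ν {u} = 0) {s t : ℝ≥0∞}
    (hst : s + t = 1) (hs : s ≠ 0) (ht : t ≠ 0)
    (h : ∀ᵐ p, cdfCost (s • μ₁ + t • μ₂) ν p = s * cdfCost μ₁ ν p + t * cdfCost μ₂ ν p) (u : ℝ) :
    cdf μ₁ u ≤ cdf μ₂ u := by
  by_contra! hlt
  obtain ⟨c, hc2, hc1⟩ := exists_between hlt
  -- To the right of `u`, right-continuity keeps `cdf μ₂` below `c`, while monotonicity keeps `cdf
  -- μ₁` above its value at `u`.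
  have hev : ∀ᶠ x in 𝓝[>] u, cdf μ₂ x < c :=
    ((cdf μ₂).right_continuous u).mono_left (nhdsWithin_mono u Ioi_subset_Ici_self)
      |>.eventually (gt_mem_nhds hc2)
  obtain ⟨w, hw, hI⟩ := (mem_nhdsGT_iff_exists_Ioo_subset).1 hev
  have hG := continuous_cdf ν hν
  obtain ⟨m, hm1, hm2⟩ := exists_between hc1
  -- Absence of atoms enters here: a continuous distribution function takes every value in `(0, 1)`,
  -- so the rectangle is nonempty.
  obtain ⟨v, hv⟩ : m ∈ range (cdf ν) := by
    have h0 : 0 < m := ((cdf_nonneg μ₂ u).trans_lt hc2).trans hm1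
    have h1 : m < 1 := hm2.trans_le (cdf_le_one μ₁ u)
    obtain ⟨x, hx⟩ := ((tendsto_cdf_atBot ν).eventually (gt_mem_nhds h0)).exists
    obtain ⟨y, hy⟩ := ((tendsto_cdf_atTop ν).eventually (lt_mem_nhds h1)).exists
    exact mem_range_of_exists_le_of_exists_ge hG ⟨x, hx.le⟩ ⟨y, hy.le⟩
  have hopen : IsOpen (Ioo u w ×ˢ (cdf ν ⁻¹' Ioo c (cdf μ₁ u))) :=
    isOpen_Ioo.prod (isOpen_Ioo.preimage hG)
  obtain ⟨x, hx⟩ := nonempty_Ioo.2 (mem_Ioi.1 hw)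
  obtain ⟨⟨x', v'⟩, ⟨hx', hv'⟩, he⟩ := (Measure.dense_of_ae h).inter_open_nonempty _ hopen
    ⟨(x, v), hx, by simpa [hv] using ⟨hm1, hm2⟩⟩
  have e2 : cdf μ₂ x' < cdf ν v' := lt_trans (hI hx') hv'.1
  have e1 : cdf ν v' < cdf μ₁ x' := hv'.2.trans_le (monotone_cdf μ₁ hx'.1.le)
  refine (cdfCost_mix_lt μ₁ μ₂ ν hst hs ht (u := x') (v := v') ?_ ?_).ne he
  · rw [← ofReal_cdf, ← ofReal_cdf]
    exact (ENNReal.ofReal_lt_ofReal_iff_of_nonneg (cdf_nonneg _ _)).2 e2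
  · rw [← ofReal_cdf, ← ofReal_cdf]
    exact (ENNReal.ofReal_lt_ofReal_iff_of_nonneg (cdf_nonneg _ _)).2 e1

/-- If `ν` has no atoms, then the transport cost to `ν` is strictly convex along mixtures. -/
theorem eq_of_ae_cdfCost_mix_eq (μ₁ μ₂ ν : Measure ℝ) [IsProbabilityMeasure μ₁]
    [IsProbabilityMeasure μ₂] [IsProbabilityMeasure ν] (hν : ∀ u, ν {u} = 0) {s t : ℝ≥0∞}
    (hst : s + t = 1) (hs : s ≠ 0) (ht : t ≠ 0)
    (h : ∀ᵐ p, cdfCost (s • μ₁ + t • μ₂) ν p = s * cdfCost μ₁ ν p + t * cdfCost μ₂ ν p) :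
    μ₁ = μ₂ := by
  refine Measure.eq_of_cdf μ₁ μ₂ (StieltjesFunction.ext fun u => le_antisymm
    (cdf_le_cdf_of_ae_eq μ₁ μ₂ ν hν hst hs ht h u)
    (cdf_le_cdf_of_ae_eq μ₂ μ₁ ν hν (add_comm s t ▸ hst) ht hs ?_ u))
  filter_upwards [h] with p hp
  rw [add_comm, hp, add_comm]

/-! ### Convexity of the sliced distance along mixtures. -/

theorem projMeasure_mix (t : unitInterval) (μ₁ μ₂ : P2 K) (θ : Metric.sphere (0 : Euc d) 1) :
    projMeasure (mix t μ₁ μ₂) θ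
      = ENNReal.ofReal (1 - t) • projMeasure μ₁ θ + ENNReal.ofReal t • projMeasure μ₂ θ := by
  have e : toEuc (mix t μ₁ μ₂)
      = ENNReal.ofReal (1 - t) • toEuc μ₁ + ENNReal.ofReal t • toEuc μ₂ := by
    simp only [toEuc, mix, ProbabilityMeasure.coe_mk]
    rw [Measure.map_add _ _ measurable_subtype_coe, Measure.map_smul, Measure.map_smul]
  rw [projMeasure, e, Measure.map_add _ _ (measurable_proj θ), Measure.map_smul, Measure.map_smul]
  rfl

theorem ofReal_one_sub_add_ofReal (t : unitInterval) :
    ENNReal.ofReal (1 - t) + ENNReal.ofReal t = 1 := by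
  rw [← ENNReal.ofReal_add (sub_nonneg.2 t.2.2) t.2.1]
  simp

theorem slicedCost_mix_le (t : unitInterval) (μ₁ μ₂ ν : P2 K)
    (q : Metric.sphere (0 : Euc d) 1 × (ℝ × ℝ)) :
    slicedCost (mix t μ₁ μ₂) ν q
      ≤ ENNReal.ofReal (1 - t) * slicedCost μ₁ ν q + ENNReal.ofReal t * slicedCost μ₂ ν q := by
  rw [slicedCost, projMeasure_mix]
  exact cdfCost_mix_le _ _ _ (ofReal_one_sub_add_ofReal t) _

theorem lintegral_mix_slicedCost (t : unitInterval) (μ₁ μ₂ ν : P2 K) :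
    ∫⁻ q, (ENNReal.ofReal (1 - t) * slicedCost μ₁ ν q + ENNReal.ofReal t * slicedCost μ₂ ν q)
        ∂((sphereUniform d).prod volume)
      = ENNReal.ofReal (1 - t) * slicedWassersteinSq (toEuc μ₁) (toEuc ν)
        + ENNReal.ofReal t * slicedWassersteinSq (toEuc μ₂) (toEuc ν) := by
  rw [lintegral_add_left ((measurable_slicedCost μ₁ ν).const_mul _),
    lintegral_const_mul _ (measurable_slicedCost μ₁ ν),
    lintegral_const_mul _ (measurable_slicedCost μ₂ ν), slicedWassersteinSq_eq_lintegral,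
    slicedWassersteinSq_eq_lintegral]

theorem slicedWassersteinSq_mix_le (t : unitInterval) (μ₁ μ₂ ν : P2 K) :
    slicedWassersteinSq (toEuc (mix t μ₁ μ₂)) (toEuc ν)
      ≤ ENNReal.ofReal (1 - t) * slicedWassersteinSq (toEuc μ₁) (toEuc ν)
        + ENNReal.ofReal t * slicedWassersteinSq (toEuc μ₂) (toEuc ν) := by
  rw [← lintegral_mix_slicedCost, slicedWassersteinSq_eq_lintegral]
  exact lintegral_mono fun q => slicedCost_mix_le t μ₁ μ₂ ν q

/-- The fibre of the projection is a hyperplane: it cannot contain both `0` and `θ`, so it is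
Lebesgue null. -/
theorem projMeasure_singleton_eq_zero {ν : P2 K} (hν : toEuc ν ≪ volume)
    (θ : Metric.sphere (0 : Euc d) 1) (u : ℝ) : projMeasure ν θ {u} = 0 := by
  rw [projMeasure, Measure.map_apply (measurable_proj θ) (measurableSet_singleton u)]
  apply hν
  let A : AffineSubspace ℝ (Euc d) :=
    (AffineSubspace.mk' u (⊥ : Submodule ℝ ℝ)).comap
      (innerₛₗ ℝ (θ : Euc d)).toAffineMap
  have hA : ∀ x, x ∈ A ↔ proj θ x = u := by
    intro x
    simp [A, proj, real_inner_comm, AffineSubspace.mem_mk', sub_eq_zero]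
  have hne : A ≠ ⊤ := by
    intro h
    have h0 := (hA 0).1 (h ▸ AffineSubspace.mem_top ℝ _ _)
    have h1 := (hA θ).1 (h ▸ AffineSubspace.mem_top ℝ _ _)
    rw [← h0] at h1
    simp [proj] at h1
  refine measure_mono_null (fun x hx => ?_) (Measure.addHaar_affineSubspace volume A hne)
  exact (hA x).2 hx

/-! ### Cramér–Wold: recovering a measure from its projections. -/

theorem charFun_projMeasure (μ : P2 K) (θ : Metric.sphere (0 : Euc d) 1) (r : ℝ) :
    charFun (projMeasure μ θ) r = charFun (toEuc μ) (r • (θ : Euc d)) := by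
  rw [charFun_apply, charFun_apply, projMeasure,
    integral_map (measurable_proj θ).aemeasurable (by fun_prop)]
  simp [proj, inner_smul_right]

theorem injective_toEuc (hK : IsCompact K) : Function.Injective (toEuc : P2 K → _) := by
  intro μ₁ μ₂ h
  have hemb := MeasurableEmbedding.subtype_coe hK.measurableSet
  apply Subtype.ext
  change (μ₁ : Measure K) = (μ₂ : Measure K)
  rw [← hemb.comap_map (μ₁ : Measure K), ← hemb.comap_map (μ₂ : Measure K)]
  exact congrArg _ h

instance (d : ℕ) : (sphereUniform d).IsOpenPosMeasure :=
  Measure.isOpenPosMeasure_smul _ (ENNReal.inv_ne_zero.2 (measure_ne_top _ _))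

/-- Two measures with the same projections in almost every direction are equal. -/
theorem eq_of_ae_projMeasure_eq (hK : IsCompact K) {μ₁ μ₂ : P2 K}
    (h : ∀ᵐ θ ∂(sphereUniform d), projMeasure μ₁ θ = projMeasure μ₂ θ) : μ₁ = μ₂ := by
  refine injective_toEuc hK (Measure.ext_of_charFun (funext fun x => ?_))
  rcases eq_or_ne x 0 with rfl | hx
  · simp
  -- Agreement on almost every direction is agreement on a dense set, since the sphere measure
  -- charges open sets; continuity of characteristic functions extends it to all directions.
  have hcl : IsClosed {θ : Metric.sphere (0 : Euc d) 1 |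
      charFun (toEuc μ₁) (‖x‖ • (θ : Euc d)) = charFun (toEuc μ₂) (‖x‖ • (θ : Euc d))} :=
    isClosed_eq (continuous_charFun.comp (by fun_prop)) (continuous_charFun.comp (by fun_prop))
  have hall : closure {θ : Metric.sphere (0 : Euc d) 1 |
      charFun (toEuc μ₁) (‖x‖ • (θ : Euc d)) = charFun (toEuc μ₂) (‖x‖ • (θ : Euc d))} = univ := by
    refine (Measure.dense_of_ae (h.mono fun θ hθ => ?_)).closure_eq
    rw [← charFun_projMeasure, ← charFun_projMeasure, hθ]
  have hmem : (⟨‖x‖⁻¹ • x, by simp [norm_smul, hx]⟩ : Metric.sphere (0 : Euc d) 1) ∈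
      closure {θ : Metric.sphere (0 : Euc d) 1 |
        charFun (toEuc μ₁) (‖x‖ • (θ : Euc d)) = charFun (toEuc μ₂) (‖x‖ • (θ : Euc d))} :=
    hall ▸ mem_univ _
  rw [hcl.closure_eq] at hmem
  simpa [smul_smul, hx] using hmem

/-! ### Strict convexity of the objective and uniqueness. -/

/-- Strict convexity of the squared sliced-Wasserstein distance to an absolutely continuous
measure. -/
theorem slicedWassersteinSq_mix_lt (hK : IsCompact K) {μ₁ μ₂ ν : P2 K} (hν : toEuc ν ≪ volume)
    (hne : μ₁ ≠ μ₂) {t : unitInterval} (h0 : 0 < t) (h1 : t < 1) :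
    slicedWassersteinSq (toEuc (mix t μ₁ μ₂)) (toEuc ν)
      < ENNReal.ofReal (1 - t) * slicedWassersteinSq (toEuc μ₁) (toEuc ν)
        + ENNReal.ofReal t * slicedWassersteinSq (toEuc μ₂) (toEuc ν) := by
  by_contra! hle
  refine hne (eq_of_ae_projMeasure_eq hK ?_)
  rw [← lintegral_mix_slicedCost, slicedWassersteinSq_eq_lintegral] at hle
  -- A pointwise inequality whose integrals are finite and fail to be strictly ordered is an
  -- equality almost everywhere.
  have hae := ae_eq_of_ae_le_of_lintegral_le
    (Eventually.of_forall (slicedCost_mix_le t μ₁ μ₂ ν))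
    (by rw [← slicedWassersteinSq_eq_lintegral]; exact (slicedWassersteinSq_lt_top hK _ _).ne)
    (((measurable_slicedCost μ₁ ν).const_mul _).add
      ((measurable_slicedCost μ₂ ν).const_mul _)).aemeasurable hle
  filter_upwards [Measure.ae_ae_of_ae_prod hae] with θ hθ
  refine eq_of_ae_cdfCost_mix_eq _ _ (projMeasure ν θ) (projMeasure_singleton_eq_zero hν θ)
    (ofReal_one_sub_add_ofReal t) ?_ ?_ ?_
  · exact (ENNReal.ofReal_pos.2 (sub_pos.2 h1)).ne'
  · exact (ENNReal.ofReal_pos.2 h0).ne'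
  · filter_upwards [hθ] with p hp
    rwa [slicedCost, projMeasure_mix] at hp

theorem toReal_mix (hK : IsCompact K) (t : unitInterval) (μ₁ μ₂ ν : P2 K) :
    (ENNReal.ofReal (1 - t) * slicedWassersteinSq (toEuc μ₁) (toEuc ν)
        + ENNReal.ofReal t * slicedWassersteinSq (toEuc μ₂) (toEuc ν)).toReal
      = (1 - t) * (slicedWassersteinSq (toEuc μ₁) (toEuc ν)).toReal
        + t * (slicedWassersteinSq (toEuc μ₂) (toEuc ν)).toReal := by
  have hfin := fun ρ : P2 K => (slicedWassersteinSq_lt_top hK ρ ν).ne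
  rw [ENNReal.toReal_add (ENNReal.mul_ne_top ENNReal.ofReal_ne_top (hfin _))
    (ENNReal.mul_ne_top ENNReal.ofReal_ne_top (hfin _)), ENNReal.toReal_mul, ENNReal.toReal_mul,
    ENNReal.toReal_ofReal (sub_nonneg.2 t.2.2), ENNReal.toReal_ofReal t.2.1]

theorem mix_slicedWassersteinSq_ne_top (hK : IsCompact K) (t : unitInterval) (μ₁ μ₂ ν : P2 K) :
    ENNReal.ofReal (1 - t) * slicedWassersteinSq (toEuc μ₁) (toEuc ν)
        + ENNReal.ofReal t * slicedWassersteinSq (toEuc μ₂) (toEuc ν) ≠ ∞ :=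
  have hfin := fun ρ : P2 K => (slicedWassersteinSq_lt_top hK ρ ν).ne
  ENNReal.add_ne_top.2 ⟨ENNReal.mul_ne_top ENNReal.ofReal_ne_top (hfin _),
    ENNReal.mul_ne_top ENNReal.ofReal_ne_top (hfin _)⟩

theorem objective_mix_lt_of_isStrictConvex (hK : IsCompact K) {F : P2 K → ℝ}
    (hF : IsStrictConvex F) {τ : ℝ} (hτ : 0 < τ) {μ₁ μ₂ : P2 K} (ν : P2 K) (hne : μ₁ ≠ μ₂)
    {t : unitInterval} (h0 : 0 < t) (h1 : t < 1) :
    objective τ F ν (mix t μ₁ μ₂)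
      < (1 - t) * objective τ F ν μ₁ + t * objective τ F ν μ₂ := by
  have hS := ENNReal.toReal_mono (mix_slicedWassersteinSq_ne_top hK t μ₁ μ₂ ν)
    (slicedWassersteinSq_mix_le t μ₁ μ₂ ν)
  rw [toReal_mix hK] at hS
  have := div_le_div_of_nonneg_right hS (by positivity : 0 ≤ 2 * τ)
  calc _ < _ := add_lt_add_of_le_of_lt this (hF μ₁ μ₂ t hne h0 h1)
    _ = _ := by unfold objective; ring

theorem objective_mix_lt_of_isConvex (hK : IsCompact K) {F : P2 K → ℝ}
    (hF : IsConvex F) {τ : ℝ} (hτ : 0 < τ) {μ₁ μ₂ ν : P2 K} (hν : toEuc ν ≪ volume) (hne : μ₁ ≠ μ₂)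
    {t : unitInterval} (h0 : 0 < t) (h1 : t < 1) :
    objective τ F ν (mix t μ₁ μ₂)
      < (1 - t) * objective τ F ν μ₁ + t * objective τ F ν μ₂ := by
  have hS := (ENNReal.toReal_lt_toReal (slicedWassersteinSq_lt_top hK _ _).ne
    (mix_slicedWassersteinSq_ne_top hK t μ₁ μ₂ ν)).2 (slicedWassersteinSq_mix_lt hK hν hne h0 h1)
  rw [toReal_mix hK] at hS
  have := div_lt_div_of_pos_right hS (by positivity : 0 < 2 * τ)
  calc _ < _ := add_lt_add_of_lt_of_le this (hF μ₁ μ₂ t)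
    _ = _ := by unfold objective; ring

theorem IsStep.eq_of_objective_mix_lt {τ : ℝ} {F : P2 K → ℝ} {ν μ₁ μ₂ : P2 K}
    (h : ∀ t : unitInterval, μ₁ ≠ μ₂ → 0 < t → t < 1 → objective τ F ν (mix t μ₁ μ₂)
      < (1 - t) * objective τ F ν μ₁ + t * objective τ F ν μ₂)
    (hμ₁ : IsStep τ F ν μ₁) (hμ₂ : IsStep τ F ν μ₂) : μ₁ = μ₂ := by
  by_contra hne
  -- The midpoint of two distinct minimizers would have a strictly smaller objective.
  let t : unitInterval := ⟨1 / 2, by norm_num, by norm_num⟩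
  have hlt := h t hne (Subtype.mk_lt_mk.2 (by norm_num)) (Subtype.mk_lt_mk.2 (by norm_num))
  have e1 := hμ₁ (mix t μ₁ μ₂)
  have e2 := hμ₂ (mix t μ₁ μ₂)
  have e3 : (t : ℝ) = 1 / 2 := rfl
  rw [e3] at hlt
  linarith

end SWJKO

theorem mainTheorem1 (d : ℕ) (K : Set (SWJKO.Euc d)) (hK : IsCompact K)
    (F : SWJKO.P2 K → ℝ) (hF : LowerSemicontinuous F)
    (τ : ℝ) (hτ : 0 < τ) (μk : SWJKO.P2 K) :
    (∃ μ : SWJKO.P2 K, SWJKO.IsStep τ F μk μ) ∧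
    (SWJKO.toEuc μk ≪ MeasureTheory.volume → SWJKO.IsConvex F →
      ∃! μ : SWJKO.P2 K, SWJKO.IsStep τ F μk μ) ∧
    (SWJKO.IsStrictConvex F → ∃! μ : SWJKO.P2 K, SWJKO.IsStep τ F μk μ) := by
  obtain ⟨μ, hμ⟩ := SWJKO.exists_isStep hK hF hτ μk
  refine ⟨⟨μ, hμ⟩, fun hac hconv => ⟨μ, hμ, fun ρ hρ => ?_⟩, fun hconv => ⟨μ, hμ, fun ρ hρ => ?_⟩⟩
  · exact SWJKO.IsStep.eq_of_objective_mix_lt (fun _ hne h0 h1 =>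
      SWJKO.objective_mix_lt_of_isConvex hK hconv hτ hac hne h0 h1) hρ hμ
  · exact SWJKO.IsStep.eq_of_objective_mix_lt (fun _ hne h0 h1 =>
      SWJKO.objective_mix_lt_of_isStrictConvex hK hconv hτ μk hne h0 h1) hρ hμ
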